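/- \textbf{Setting.} Let $M\in\mathbb N$. For every sample size $n$ let $X_n$ be an observable with values in a measurable space $\mathcal X_n$, and let $\nu_n$ be a measure on $\mathcal X_n$. For $m=1,\dots,M$ let $\Theta_m\subseteq\mathbb R^{g_m}$ be open and let the model class $\mathcal M_m$ consist of the probability distributions $F_{mn}(\theta)$, $\theta\in\Theta_m$, with densities $f_{mn}(\cdot;\theta)$ with respect to $\nu_n$. Fix $m,m'\in\{1,\dots,M\}$ (possibly equal) and $\theta'\in\Theta_{m'}$, and suppose that $X_n\sim F_{m'n}(\theta')$ for all $n$; all probabilities, covariances and limits in law below are taken under these distributions. Write $U_{mn}(\theta;x)=\nabla_\theta\log f_{mn}(x;\theta)$ for the score, $A_{mn}(\theta;x)=-\nabla^2_{\theta}\log f_{mn}(x;\theta)$ for the observed information matrix, and $$K^{(n)}(\theta)=\int \log\frac{f_{mn}(x;\theta)}{f_{m'n}(x;\theta')}\,f_{m'n}(x;\theta')\,\nu_n(dx),\qquad \theta\in\Theta_m .$$ \textbf{Assumptions.} \begin{enumerate} \item $\tau_m:\Theta_m\to\mathbb R$ is continuously differentiable. For every $n$, almost surely, $f_{mn}(X_n;\theta)>0$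 for all $\theta\in\Theta_m$ and $\theta\mapsto\log f_{mn}(X_n;\theta)$ is twice continuously differentiable on $\Theta_m$. \item The integrals $K^{(n)}(\theta)$ exist and are finite, and $K(\theta)=\lim_{n}\frac1n K^{(n)}(\theta)$ exists in $\mathbb R$, for every $\theta\in\Theta_m$. The points $\theta^{*(n)}\in\Theta_m$ maximize $K^{(n)}$ over $\Theta_m$ for all large $n$, $\theta^*\in\Theta_m$ is the unique maximizer of $K$ over $\Theta_m$, and $\theta^{*(n)}\to\theta^*$. \item $\frac1n\log\frac{f_{mn}(X_n;\theta)}{f_{m'n}(X_n;\theta')}\to K(\theta)$ in probability, uniformly in $\theta$ on each compact subset of $\Theta_m$; and there is a compact $C\subseteq\Theta_m$ such that, with probability tending to one, $f_{mn}(X_n;\theta)<f_{mn}(X_n;\theta^*)$ for all $\theta\in\Theta_m\setminus C$. \item There is a matrix function $A$ such that $\frac1nA_{mn}(\theta;X_n)\to A(\theta)$ in probability, uniformly in $\theta$ on a neighbourhood of $\theta^*$, and $A(\theta^*)$ is invertible. \item For all large $n$ the score $U_{mn}(\theta^{*(n)};X_n)$ is square integrable; the limit $\Sigma=\lim_n\frac1n\operatorname{Cov}\{U_{mn}(\theta^{*(n)};X_n)\}$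 exists; and $\frac1{\sqrt n}U_{mn}(\theta^{*(n)};X_n)\xrightarrow{d}N(0,\Sigma)$. \item $\hat\theta_{mn}=\hat\theta_{mn}(X_n)$ is a measurable $\Theta_m$-valued estimator which, with probability tending to one, is a maximum likelihood estimate in the class $\mathcal M_m$, i.e. maximizes $\theta\mapsto f_{mn}(X_n;\theta)$ over $\Theta_m$. \end{enumerate} \textbf{Conclusion.} Put $\Xi=A(\theta^*)^{-1}\,\Sigma\,A(\theta^*)^{-1}$ and $\Gamma=\nabla\tau_m(\theta^*)^{\mathsf t}\,\Xi\,\nabla\tau_m(\theta^*)$. Then $\Gamma\ge0$ and, as $n\to\infty$, $$\sqrt n\left(\tau_m(\hat\theta_{mn})-\tau_m(\theta^{*(n)})\right)\xrightarrow{d}N(0,\Gamma).$$ -/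

import Mathlib

open MeasureTheory ProbabilityTheory Filter Topology
open scoped Matrix

noncomputable section

/-- Finitely many parametric model classes for a sequence of observables `X n` with values in `𝒳 n`:
the class `m` has an open parameter set `Θ m` in a Euclidean space, and at sample size `n` it
consists of the probability distributions with densities `density m n θ`, `θ ∈ Θ m`, with respect to
a dominating measure `ν n`. -/
structure ModelClasses (M : ℕ) (𝒳 : ℕ → Type*) [∀ n, MeasurableSpace (𝒳 n)] where
  ν : ∀ n, Measure (𝒳 n)
  dim : Fin M → ℕ
  Θ : ∀ m, Set (EuclideanSpace ℝ (Fin (dim m)))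
  isOpen_Θ : ∀ m, IsOpen (Θ m)
  density : ∀ (m : Fin M) (n : ℕ), EuclideanSpace ℝ (Fin (dim m)) → 𝒳 n → ℝ
  measurable_density : ∀ m n, ∀ θ ∈ Θ m, Measurable (density m n θ)
  density_nonneg : ∀ m n, ∀ θ ∈ Θ m, ∀ x, 0 ≤ density m n θ x
  lintegral_density : ∀ m n, ∀ θ ∈ Θ m, ∫⁻ x, ENNReal.ofReal (density m n θ x) ∂ν n = 1

namespace ModelClasses

variable {M : ℕ} {𝒳 : ℕ → Type*} [∀ n, MeasurableSpace (𝒳 n)] (𝓜 : ModelClasses M 𝒳)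

/-- The Euclidean space that contains the parameter set of the class `m`. -/
abbrev Param (m : Fin M) : Type := EuclideanSpace ℝ (Fin (𝓜.dim m))

/-- The distribution of the observable at sample size `n` under the parameter `θ` of the class `m`. -/
def law (m : Fin M) (θ : 𝓜.Θ m) (n : ℕ) : Measure (𝒳 n) :=
  (𝓜.ν n).withDensity fun x => ENNReal.ofReal (𝓜.density m n θ x)

instance isProbabilityMeasure_law (m : Fin M) (θ : 𝓜.Θ m) (n : ℕ) :
    IsProbabilityMeasure (𝓜.law m θ n) :=
  ⟨by rw [law, withDensity_apply _ MeasurableSet.univ, Measure.restrict_univ]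
      exact 𝓜.lintegral_density m n θ θ.2⟩

/-- The integrand of the Kullback–Leibler functional. -/
def klIntegrand (m m' : Fin M) (θ' : 𝓜.Θ m') (n : ℕ) (θ : 𝓜.Param m) (x : 𝒳 n) : ℝ :=
  Real.log (𝓜.density m n θ x / 𝓜.density m' n θ' x) * 𝓜.density m' n θ' x

/-- The Kullback–Leibler functional `K⁽ⁿ⁾(θ, θ') = ∫ log (f_{m,n}(x; θ) / f_{m',n}(x; θ'))
f_{m',n}(x; θ') ν_n(dx)` (with the sign for which it is nonpositive, so it is to be maximised). -/
def kl (m m' : Fin M) (θ' : 𝓜.Θ m') (n : ℕ) (θ : 𝓜.Param m) : ℝ :=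
  ∫ x, 𝓜.klIntegrand m m' θ' n θ x ∂𝓜.ν n

/-- The log-likelihood of the class `m` at sample size `n`. -/
def logLik (m : Fin M) (n : ℕ) (θ : 𝓜.Param m) (x : 𝒳 n) : ℝ :=
  Real.log (𝓜.density m n θ x)

/-- The score function: the gradient of the log-likelihood in the parameter. -/
def score (m : Fin M) (n : ℕ) (θ : 𝓜.Param m) (x : 𝒳 n) : 𝓜.Param m :=
  gradient (fun t => 𝓜.logLik m n t x) θ

/-- The observed information matrix: minus the Hessian matrix of the log-likelihood. -/
def obsInfo (m : Fin M) (n : ℕ) (θ : 𝓜.Param m) (x : 𝒳 n) :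
    Matrix (Fin (𝓜.dim m)) (Fin (𝓜.dim m)) ℝ :=
  Matrix.of fun i j =>
    -(fderiv ℝ (fun t => 𝓜.score m n t x) θ (EuclideanSpace.single j (1 : ℝ))) i

/-- The covariance matrix of the score of the class `m` at `θ`, when the observable is distributed
according to the parameter `θ'` of the class `m'`. -/
def scoreCov (m m' : Fin M) (θ' : 𝓜.Θ m') (n : ℕ) (θ : 𝓜.Param m) :
    Matrix (Fin (𝓜.dim m)) (Fin (𝓜.dim m)) ℝ :=
  Matrix.of fun i j =>
    covariance (fun x => 𝓜.score m n θ x i) (fun x => 𝓜.score m n θ x j) (𝓜.law m' θ' n)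

/-- `t` is a maximum likelihood estimate in the class `m` for the data `x`. -/
def IsMLE (m : Fin M) (n : ℕ) (x : 𝒳 n) (t : 𝓜.Θ m) : Prop :=
  ∀ θ ∈ 𝓜.Θ m, 𝓜.density m n θ x ≤ 𝓜.density m n t x

end ModelClasses

/-- Uniform convergence in probability on `S` of the random functions `Z n` to the function `z`:
`P n (sup_{t ∈ S} |Z n t - z t| ≥ ε) → 0` for all `ε > 0`. -/
def UnifTendstoInProb {𝒳 : ℕ → Type*} [∀ n, MeasurableSpace (𝒳 n)] {T : Type*}
    (P : ∀ n, Measure (𝒳 n)) (S : Set T) (Z : ∀ n, T → 𝒳 n → ℝ) (z : T → ℝ) : Prop :=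
  ∀ ε : ℝ, 0 < ε → Tendsto (fun n => P n {x | ∃ t ∈ S, ε ≤ |Z n t x - z t|}) atTop (𝓝 0)

/-- The sandwich matrix `A⁻¹ Σ A⁻¹`. -/
def sandwich {d : ℕ} (A S : Matrix (Fin d) (Fin d) ℝ) : Matrix (Fin d) (Fin d) ℝ :=
  A⁻¹ * S * A⁻¹

/-- The quadratic form `vᵀ Ξ v` at the gradient `v` of `τ` at `θ`. -/
def deltaVariance {d : ℕ} (τ : EuclideanSpace ℝ (Fin d) → ℝ) (θ : EuclideanSpace ℝ (Fin d))
    (Ξ : Matrix (Fin d) (Fin d) ℝ) : ℝ :=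
  (gradient τ θ).ofLp ⬝ᵥ (Ξ *ᵥ (gradient τ θ).ofLp)

end

/-! Near `θstar` the score is almost affine. The normalised observed information is uniformly close
to `A`, and `A` is continuous at `θstar`, so with high probability `score b - score a = -n
A(θstar)(b - a)` up to `n ε ‖b - a‖`, simultaneously for all `a`, `b` in a small ball
(`exists_ball_holdsWHP_score_expansion`). Take `a = θseq n` and `b = θhat`: the latter lies in the
ball by consistency (`holdsWHP_estimator_mem`), and the score vanishes there.

With `w = √n (θhat - θseq n)` and `z = score / √n` this reads `‖A w - z‖ ≤ ε ‖w‖`. Since `A` is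
invertible, the error is absorbed for small `ε`, giving `‖w‖ ≤ 2 ‖A⁻¹‖ ‖z‖` without a separate proof
of the `√n` rate. Strict differentiability of `τ` then shows that `√n (τ θhat - τ (θseq n))` differs
from `⟪∇τ, A⁻¹ z⟫` by at most `η ‖z‖`, for any prescribed `η` (`abs_sub_inner_le_of_linearization`).

As `z` converges in law it is tight, so the difference vanishes in probability and Slutsky's lemma
applies. The linear term has a Gaussian limit, and symmetry of `A` identifies its variance with the
sandwich form. -/

/-! ### Events of probability tending to one, tightness and Slutsky's lemma. -/

section HighProbability

variable {𝒳 : ℕ → Type*} [∀ n, MeasurableSpace (𝒳 n)] {P : ∀ n, Measure (𝒳 n)}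

/-- The events `{x | p n x}` have probability tending to one. -/
def HoldsWHP (P : ∀ n, Measure (𝒳 n)) (p : ∀ n, 𝒳 n → Prop) : Prop :=
  Tendsto (fun n => P n {x | ¬ p n x}) atTop (𝓝 0)

/-- No measurability of the events is needed: monotonicity of the outer measure suffices here, and
subadditivity for the conjunctions below. -/
theorem HoldsWHP.mono_ae {p q : ∀ n, 𝒳 n → Prop} (hp : HoldsWHP P p)
    (h : ∀ᶠ n in atTop, ∀ᵐ x ∂P n, p n x → q n x) : HoldsWHP P q := by
  refine tendsto_of_tendsto_of_tendsto_of_le_of_le' tendsto_const_nhds hp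
    (Eventually.of_forall fun _ => zero_le) ?_
  filter_upwards [h] with n hn
  refine measure_mono_ae ?_
  filter_upwards [hn] with x hx hq hp'
  exact hq (hx hp')

theorem HoldsWHP.and {p q : ∀ n, 𝒳 n → Prop} (hp : HoldsWHP P p) (hq : HoldsWHP P q) :
    HoldsWHP P (fun n x => p n x ∧ q n x) := by
  have h := Tendsto.add hp hq
  rw [add_zero] at h
  refine tendsto_of_tendsto_of_tendsto_of_le_of_le tendsto_const_nhds h (fun _ => zero_le) ?_
  intro n
  refine (measure_mono ?_).trans (measure_union_le _ _)
  intro x hx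
  simp only [Set.mem_ofPred_eq, Set.mem_union] at hx ⊢
  tauto

theorem HoldsWHP.of_ae {p : ∀ n, 𝒳 n → Prop} (h : ∀ᶠ n in atTop, ∀ᵐ x ∂P n, p n x) :
    HoldsWHP P p := by
  refine tendsto_const_nhds.congr' ?_
  filter_upwards [h] with n hn
  exact (ae_iff.1 hn).symm

/-- This turns high-probability statements into deterministic facts about limits, such as continuity
and symmetry: a single good sample point is enough. -/
theorem HoldsWHP.exists [∀ n, IsProbabilityMeasure (P n)] {p : ∀ n, 𝒳 n → Prop}
    (hp : HoldsWHP P p) : ∃ n x, p n x := by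
  obtain ⟨n, hn⟩ := (Tendsto.eventually_lt_const one_pos hp).exists
  refine ⟨n, ?_⟩
  by_contra! h
  have : {x | ¬ p n x} = Set.univ := Set.eq_univ_of_forall h
  rw [this, measure_univ] at hn
  exact lt_irrefl _ hn

theorem HoldsWHP.forall_finite {ι : Type*} [Finite ι] {p : ι → ∀ n, 𝒳 n → Prop}
    (h : ∀ i, HoldsWHP P (p i)) : HoldsWHP P (fun n x => ∀ i, p i n x) := by
  have := Fintype.ofFinite ι
  have h' := tendsto_finsetSum Finset.univ fun i _ => h i
  simp only [Finset.sum_const_zero] at h'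
  refine tendsto_of_tendsto_of_tendsto_of_le_of_le tendsto_const_nhds h' (fun _ => zero_le) ?_
  intro n
  refine (measure_mono ?_).trans (measure_biUnion_finset_le Finset.univ _)
  intro x hx
  simpa using hx

theorem UnifTendstoInProb.holdsWHP {T : Type*} {S : Set T} {Z : ∀ n, T → 𝒳 n → ℝ} {z : T → ℝ}
    (h : UnifTendstoInProb P S Z z) {ε : ℝ} (hε : 0 < ε) :
    HoldsWHP P (fun n x => ∀ t ∈ S, |Z n t x - z t| < ε) := by
  refine (h ε hε).congr fun n => ?_
  simp

theorem UnifTendstoInProb.mono {T : Type*} {S S' : Set T} {Z : ∀ n, T → 𝒳 n → ℝ} {z : T → ℝ}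
    (h : UnifTendstoInProb P S Z z) (hS : S' ⊆ S) : UnifTendstoInProb P S' Z z := fun ε hε =>
  tendsto_of_tendsto_of_tendsto_of_le_of_le tendsto_const_nhds (h ε hε) (fun _ => zero_le)
    fun _ => measure_mono fun _ ⟨t, ht, hx⟩ => ⟨t, hS ht, hx⟩

/-- A uniform limit in probability of random functions which are almost surely continuous on `S` is
continuous on `S`. -/
theorem UnifTendstoInProb.continuousOn [∀ n, IsProbabilityMeasure (P n)] {T : Type*}
    [TopologicalSpace T] {S : Set T} {Z : ∀ n, T → 𝒳 n → ℝ} {z : T → ℝ}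
    (h : UnifTendstoInProb P S Z z)
    (hZ : ∀ n, ∀ᵐ x ∂P n, ContinuousOn (fun t => Z n t x) S) : ContinuousOn z S := by
  refine continuousOn_of_uniform_approx_of_continuousOn fun u hu => ?_
  obtain ⟨ε, hε, hεu⟩ := Metric.mem_uniformity_dist.1 hu
  obtain ⟨n, x, hx, hx'⟩ :=
    ((h.holdsWHP hε).and (HoldsWHP.of_ae (Eventually.of_forall hZ))).exists
  refine ⟨fun t => Z n t x, hx', fun t ht => hεu ?_⟩
  rw [dist_comm, Real.dist_eq]
  exact hx t ht

/-- Tightness: the tails of the limit law decrease to zero along integer radii, and the portmanteau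
inequality for closed sets transfers a small tail to `X n`. -/
theorem MeasureTheory.TendstoInDistribution.eventually_measure_norm_ge_le [∀ n, IsProbabilityMeasure (P n)]
    {E Ω : Type*} [NormedAddCommGroup E] [MeasurableSpace E] [BorelSpace E]
    {mΩ : MeasurableSpace Ω} {μ : Measure Ω} [IsProbabilityMeasure μ]
    {X : ∀ n, 𝒳 n → E} {Z : Ω → E} (h : TendstoInDistribution X atTop Z P μ)
    {ε : ENNReal} (hε : 0 < ε) :
    ∃ R : ℝ, ∀ᶠ n in atTop, P n {x | R ≤ ‖X n x‖} ≤ ε := by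
  set ρ : Measure E := μ.map Z with hρ
  have hρp : IsProbabilityMeasure ρ := Measure.isProbabilityMeasure_map h.aemeasurable_limit
  have hclosed (R : ℝ) : IsClosed {v : E | R ≤ ‖v‖} := isClosed_le continuous_const continuous_norm
  have hlim : Tendsto (fun k : ℕ => ρ {v : E | (k : ℝ) ≤ ‖v‖}) atTop (𝓝 0) := by
    have := tendsto_measure_iInter_atTop (μ := ρ) (s := fun k : ℕ => {v : E | (k : ℝ) ≤ ‖v‖})
      (fun k => (hclosed k).measurableSet.nullMeasurableSet)
      (fun i j hij v hv => le_trans (by exact_mod_cast hij) (Set.mem_ofPred.1 hv))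
      ⟨0, measure_ne_top _ _⟩
    have he : (⋂ k : ℕ, {v : E | (k : ℝ) ≤ ‖v‖}) = ∅ := by
      ext v
      simp only [Set.mem_iInter, Set.mem_ofPred_eq, Set.mem_empty_iff_false, iff_false, not_forall,
        not_le]
      exact exists_nat_gt ‖v‖
    rwa [he, measure_empty] at this
  obtain ⟨k, hk⟩ := (hlim.eventually_lt_const hε).exists
  refine ⟨k, ?_⟩
  have hls := ProbabilityMeasure.limsup_measure_closed_le_of_tendsto h.tendsto (hclosed k)
  have := eventually_lt_of_limsup_lt (hls.trans_lt hk)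
  filter_upwards [this] with n hn
  refine le_trans (le_of_eq ?_) hn.le
  exact (Measure.map_apply_of_aemeasurable (h.forall_aemeasurable n)
    (hclosed k).measurableSet).symm

/-- If `X n` converges in distribution and `e n ≤ η ‖X n‖` with probability tending to one for every
`η > 0`, then `e n` is asymptotically at most zero in probability. -/
theorem HoldsWHP.lt_of_le_mul_norm [∀ n, IsProbabilityMeasure (P n)]
    {E Ω : Type*} [NormedAddCommGroup E] [MeasurableSpace E] [BorelSpace E]
    {mΩ : MeasurableSpace Ω} {μ : Measure Ω} [IsProbabilityMeasure μ]
    {X : ∀ n, 𝒳 n → E} {Z : Ω → E} (h : TendstoInDistribution X atTop Z P μ)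
    {e : ∀ n, 𝒳 n → ℝ} (he : ∀ η : ℝ, 0 < η → HoldsWHP P (fun n x => e n x ≤ η * ‖X n x‖))
    {δ : ℝ} (hδ : 0 < δ) : HoldsWHP P (fun n x => e n x < δ) := by
  refine ENNReal.tendsto_nhds_zero.2 fun ε hε => ?_
  have hε2 : 0 < ε / 2 := ENNReal.half_pos hε.ne'
  obtain ⟨R, hR⟩ := h.eventually_measure_norm_ge_le hε2
  -- Off the tail event the error is then below `δ`; `|R| + 1` is positive whatever the sign of `R`.
  have hη : 0 < δ / (|R| + 1) := by positivity
  filter_upwards [hR, ENNReal.tendsto_nhds_zero.1 (he _ hη) _ hε2] with n h1 h2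
  calc P n {x | ¬ e n x < δ}
      ≤ P n ({x | R ≤ ‖X n x‖} ∪ {x | ¬ e n x ≤ δ / (|R| + 1) * ‖X n x‖}) := by
        refine measure_mono fun x hx => ?_
        simp only [Set.mem_ofPred_eq, Set.mem_union] at hx ⊢
        by_contra! hcon
        refine hx (hcon.2.trans_lt ?_)
        have h3 : ‖X n x‖ < |R| + 1 := by linarith [hcon.1, le_abs_self R]
        calc δ / (|R| + 1) * ‖X n x‖ < δ / (|R| + 1) * (|R| + 1) := by gcongr
          _ = δ := by field_simp
    _ ≤ _ := measure_union_le _ _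
    _ ≤ ε / 2 + ε / 2 := add_le_add h1 h2
    _ = ε := ENNReal.add_halves ε

/-- **Slutsky's lemma** for random variables on varying probability spaces: a perturbation that
vanishes in probability does not change the limit in distribution. -/
theorem MeasureTheory.TendstoInDistribution.of_holdsWHP_dist_lt [∀ n, IsProbabilityMeasure (P n)] {Ω : Type*}
    {mΩ : MeasurableSpace Ω} {μ : Measure Ω} [IsProbabilityMeasure μ]
    {X Y : ∀ n, 𝒳 n → ℝ} {Z : Ω → ℝ} (h : TendstoInDistribution X atTop Z P μ)
    (hY : ∀ n, AEMeasurable (Y n) (P n))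
    (hXY : ∀ δ : ℝ, 0 < δ → HoldsWHP P (fun n x => |Y n x - X n x| < δ)) :
    TendstoInDistribution Y atTop Z P μ := by
  have hZ : AEMeasurable Z μ := h.aemeasurable_limit
  have hX : ∀ n, AEMeasurable (X n) (P n) := h.forall_aemeasurable
  refine ⟨hY, hZ, ?_⟩
  -- For bounded Lipschitz test functions, `|F (Y n) - F (X n)|` is at most `L δ` where the
  -- variables are `δ`-close and at most the oscillation bound `M` elsewhere.
  suffices ∀ (F : ℝ → ℝ) (_ : ∃ C : ℝ, ∀ x y, dist (F x) (F y) ≤ C)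
      (_ : ∃ L, LipschitzWith L F),
      Tendsto (fun n => ∫ ω, F ω ∂((P n).map (Y n))) atTop (𝓝 (∫ ω, F ω ∂(μ.map Z))) by
    exact tendsto_iff_forall_lipschitz_integral_tendsto.2 this
  rintro F ⟨M, hM⟩ ⟨L, hL⟩
  have hF : Continuous F := hL.continuous
  have hXlim : Tendsto (fun n => ∫ ω, F ω ∂((P n).map (X n))) atTop
      (𝓝 (∫ ω, F ω ∂(μ.map Z))) :=
    tendsto_iff_forall_lipschitz_integral_tendsto.1 h.tendsto F ⟨M, hM⟩ ⟨L, hL⟩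
  have hM0 : 0 ≤ M := dist_nonneg.trans (hM 0 0)
  have hb (y : ℝ) : ‖F y‖ ≤ ‖F 0‖ + M := by
    have := hM y 0
    rw [dist_eq_norm] at this
    linarith [norm_sub_norm_le (F y) (F 0)]
  have hdiff : Tendsto (fun n => ∫ ω, F ω ∂((P n).map (Y n)) - ∫ ω, F ω ∂((P n).map (X n))) atTop
      (𝓝 0) := by
    rw [Metric.tendsto_atTop']
    intro ε hε
    set δ : ℝ := ε / (2 * (L + 1)) with hδ
    have hδ0 : 0 < δ := by positivity
    have hW : Tendsto (fun n => M * (P n).real {x | ¬ |Y n x - X n x| < δ}) atTop (𝓝 0) := by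
      have := ((ENNReal.tendsto_toReal ENNReal.zero_ne_top).comp (hXY δ hδ0)).const_mul M
      rwa [ENNReal.toReal_zero, mul_zero] at this
    obtain ⟨N, hN⟩ := eventually_atTop.1 (hW.eventually_lt_const (half_pos hε))
    refine ⟨N, fun n hn => ?_⟩
    have hn := hN n hn.le
    have iY : Integrable (fun x => F (Y n x)) (P n) :=
      Integrable.of_bound (hF.measurable.comp_aemeasurable (hY n)).aestronglyMeasurable _
        (ae_of_all _ fun x => hb _)
    have iX : Integrable (fun x => F (X n x)) (P n) :=
      Integrable.of_bound (hF.measurable.comp_aemeasurable (hX n)).aestronglyMeasurable _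
        (ae_of_all _ fun x => hb _)
    have hset : NullMeasurableSet {x | ¬ |Y n x - X n x| < δ} (P n) :=
      (nullMeasurableSet_lt (((hY n).sub (hX n)).norm) aemeasurable_const).compl
    rw [dist_zero_right, integral_map (hY n) hF.aestronglyMeasurable,
      integral_map (hX n) hF.aestronglyMeasurable, ← integral_sub iY iX]
    calc ‖∫ a, F (Y n a) - F (X n a) ∂P n‖
        ≤ ∫ a, ‖F (Y n a) - F (X n a)‖ ∂P n := norm_integral_le_integral_norm _
      _ ≤ ∫ a, (L * δ + Set.indicator {x | ¬ |Y n x - X n x| < δ} (fun _ => M) a) ∂P n := by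
          refine integral_mono (iY.sub iX).norm
            ((integrable_const _).add ((integrable_const M).indicator₀ hset)) fun a => ?_
          by_cases ha : |Y n a - X n a| < δ
          · simpa [ha] using hL.norm_sub_le_of_le ha.le
          · have := hM (Y n a) (X n a)
            rw [dist_eq_norm] at this
            have h0 : 0 ≤ (L : ℝ) * δ := by positivity
            simp only [Set.indicator, Set.mem_ofPred_eq, ha, not_false_eq_true, if_true]
            linarith
      _ = L * δ + M * (P n).real {x | ¬ |Y n x - X n x| < δ} := by
          rw [integral_add (integrable_const _) ((integrable_const M).indicator₀ hset),
            integral_const, integral_indicator₀ hset, setIntegral_const]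
          simp [mul_comm]
      _ < ε / 2 + ε / 2 := by
          refine add_lt_add ?_ hn
          rw [hδ, mul_div_assoc', div_lt_div_iff₀ (by positivity) two_pos]
          nlinarith [L.coe_nonneg]
      _ = ε := add_halves ε
  simpa using hdiff.add hXlim

end HighProbability

/-! ### Covariance matrices, operator norms and Gaussian marginals. -/

section Matrices

variable {d : ℕ}

theorem posSemidef_of_tendsto {S : ℕ → Matrix (Fin d) (Fin d) ℝ} {T : Matrix (Fin d) (Fin d) ℝ}
    (h : Tendsto S atTop (𝓝 T)) (hS : ∀ᶠ n in atTop, (S n).PosSemidef) : T.PosSemidef := by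
  refine .of_dotProduct_mulVec_nonneg ?_ fun x => ?_
  · have h1 : Tendsto (fun n => (S n)ᴴ) atTop (𝓝 Tᴴ) :=
      (continuous_id.matrix_conjTranspose.tendsto T).comp h
    refine tendsto_nhds_unique (h1.congr' ?_) h
    filter_upwards [hS] with n hn using hn.1
  · have hc : Continuous fun M : Matrix (Fin d) (Fin d) ℝ => star x ⬝ᵥ (M *ᵥ x) :=
      continuous_const.dotProduct (continuous_id.matrix_mulVec continuous_const)
    refine ge_of_tendsto ((hc.tendsto T).comp h) ?_
    filter_upwards [hS] with n hn using hn.dotProduct_mulVec_nonneg x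

/-- The quadratic form at `v` is the variance of the linear combination `∑ i, v i * X i`. -/
theorem posSemidef_covariance {Ω : Type*} [MeasurableSpace Ω] {P : Measure Ω}
    [IsProbabilityMeasure P] {X : Ω → EuclideanSpace ℝ (Fin d)} (hX : MemLp X 2 P) :
    (Matrix.of fun i j => covariance (fun x => X x i) (fun x => X x j) P).PosSemidef := by
  have hXi (i : Fin d) : MemLp (fun x => X x i) 2 P :=
    (EuclideanSpace.proj (𝕜 := ℝ) i).comp_memLp' hX
  refine .of_dotProduct_mulVec_nonneg ?_ fun v => ?_
  · ext i j
    simp [covariance_comm (fun x => X x j)]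
  · have hvar : covariance (fun x => ∑ i, v i * X x i) (fun x => ∑ i, v i * X x i) P
        = star v ⬝ᵥ ((Matrix.of fun i j =>
          covariance (fun x => X x i) (fun x => X x j) P) *ᵥ v) := by
      rw [covariance_fun_sum_fun_sum (fun i => (hXi i).const_mul _) fun i => (hXi i).const_mul _]
      simp only [covariance_const_mul_left, covariance_const_mul_right, dotProduct,
        Matrix.mulVec, Matrix.of_apply, Finset.mul_sum, star_trivial]
      refine Finset.sum_congr rfl fun i _ => Finset.sum_congr rfl fun j _ => by ring
    rw [← hvar, covariance_self]
    · exact variance_nonneg _ _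
    · exact (memLp_finsetSum _ fun i _ => (hXi i).const_mul (v i)).aemeasurable

/-- The constant is crude, but it depends only on the dimension, which is all that the score
expansion needs. -/
theorem norm_le_of_apply_single_le
    (L : EuclideanSpace ℝ (Fin d) →L[ℝ] EuclideanSpace ℝ (Fin d)) {ε : ℝ}
    (h : ∀ i j, |L (EuclideanSpace.single j 1) i| ≤ ε) (hε : 0 ≤ ε) : ‖L‖ ≤ d * d * ε := by
  refine L.opNorm_le_bound (by positivity) fun v => ?_
  have hcoord (u : EuclideanSpace ℝ (Fin d)) : u = ∑ i, u i • EuclideanSpace.single i (1 : ℝ) := by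
    simpa using ((EuclideanSpace.basisFun (Fin d) ℝ).sum_repr u).symm
  have hnorm (u : EuclideanSpace ℝ (Fin d)) : ‖u‖ ≤ ∑ i, |u i| := by
    conv_lhs => rw [hcoord u]
    refine (norm_sum_le _ _).trans (Finset.sum_le_sum fun i _ => ?_)
    simp [norm_smul]
  have hL (j : Fin d) : ‖L (EuclideanSpace.single j 1)‖ ≤ d * ε := by
    refine (hnorm _).trans ((Finset.sum_le_sum fun i _ => h i j).trans ?_)
    simp
  calc ‖L v‖ = ‖∑ j, v j • L (EuclideanSpace.single j 1)‖ := by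
        conv_lhs => rw [hcoord v]
        simp only [map_sum, map_smul]
    _ ≤ ∑ _j : Fin d, ‖v‖ * (d * ε) := by
        refine (norm_sum_le _ _).trans (Finset.sum_le_sum fun j _ => ?_)
        rw [norm_smul]
        exact mul_le_mul (PiLp.norm_apply_le v j) (hL j) (norm_nonneg _) (norm_nonneg _)
    _ = d * d * ε * ‖v‖ := by
        simp
        ring

theorem multivariateGaussian_map_inner {S : Matrix (Fin d) (Fin d) ℝ} (hS : S.PosSemidef)
    (w : EuclideanSpace ℝ (Fin d)) :
    (multivariateGaussian 0 S).map (fun x => inner ℝ w x)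
      = gaussianReal 0 (w.ofLp ⬝ᵥ (S *ᵥ w.ofLp)).toNNReal := by
  have h := IsGaussian.map_eq_gaussianReal (μ := multivariateGaussian 0 S) (innerSL ℝ w)
  have hmean : ∫ x, innerSL ℝ w x ∂(multivariateGaussian 0 S) = 0 := by
    rw [ContinuousLinearMap.integral_comp_comm _ IsGaussian.integrable_fun_id,
      integral_id_multivariateGaussian, map_zero]
  rw [hmean] at h
  rw [← covarianceBilin_multivariateGaussian (μ := 0) hS,
    covarianceBilin_self IsGaussian.memLp_two_id]
  exact h

/-- Moving one symmetric factor `A⁻¹` across the product exhibits the variance as the form of `S` at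
`A⁻¹ v`. Both its nonnegativity and the limit law are read off from this. -/
theorem dotProduct_sandwich_mulVec {A S : Matrix (Fin d) (Fin d) ℝ} (hA : A.IsSymm)
    (v : Fin d → ℝ) :
    v ⬝ᵥ (sandwich A S *ᵥ v) = (A⁻¹ *ᵥ v) ⬝ᵥ (S *ᵥ (A⁻¹ *ᵥ v)) := by
  have hAi : (A⁻¹)ᵀ = A⁻¹ := by rw [Matrix.transpose_nonsing_inv, hA]
  rw [sandwich, ← Matrix.mulVec_mulVec, ← Matrix.mulVec_mulVec, Matrix.dotProduct_mulVec v,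
    ← Matrix.mulVec_transpose, hAi]

theorem toEuclideanCLM_inv_apply_toEuclideanCLM {A : Matrix (Fin d) (Fin d) ℝ} (hA : IsUnit A)
    (v : EuclideanSpace ℝ (Fin d)) :
    Matrix.toEuclideanCLM (𝕜 := ℝ) A⁻¹ (Matrix.toEuclideanCLM (𝕜 := ℝ) A v) = v := by
  ext i
  rw [Matrix.ofLp_toEuclideanCLM, Matrix.ofLp_toEuclideanCLM, Matrix.mulVec_mulVec,
    Matrix.nonsing_inv_mul _ ((Matrix.isUnit_iff_isUnit_det _).1 hA), Matrix.one_mulVec]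

end Matrices

/-! ### Gradients, Hessians and linearization. -/

section Calculus

variable {d : ℕ}

theorem gradient_apply_eq_fderiv_single (g : EuclideanSpace ℝ (Fin d) → ℝ)
    (x : EuclideanSpace ℝ (Fin d)) (i : Fin d) :
    gradient g x i = fderiv ℝ g x (EuclideanSpace.single i 1) := by
  rw [← toDual_gradient, InnerProductSpace.toDual_apply_apply, EuclideanSpace.inner_single_right]
  simp

theorem ContDiffOn.gradient_of_isOpen {g : EuclideanSpace ℝ (Fin d) → ℝ}
    {Θ : Set (EuclideanSpace ℝ (Fin d))} (hg : ContDiffOn ℝ 2 g Θ) (hΘ : IsOpen Θ) :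
    ContDiffOn ℝ 1 (gradient g) Θ := by
  rw [contDiffOn_euclidean]
  intro i
  simp only [gradient_apply_eq_fderiv_single]
  exact (hg.fderiv_of_isOpen hΘ (by norm_num)).clm_apply contDiffOn_const

/-- Links the Hessian entries to the second Fréchet derivative, where symmetry is available. -/
theorem fderiv_gradient_apply_single {g : EuclideanSpace ℝ (Fin d) → ℝ}
    {Θ : Set (EuclideanSpace ℝ (Fin d))} (hg : ContDiffOn ℝ 2 g Θ) (hΘ : IsOpen Θ)
    {x : EuclideanSpace ℝ (Fin d)} (hx : x ∈ Θ) (i j : Fin d) :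
    fderiv ℝ (gradient g) x (EuclideanSpace.single j 1) i
      = fderiv ℝ (fderiv ℝ g) x (EuclideanSpace.single j 1) (EuclideanSpace.single i 1) := by
  have h1 : DifferentiableAt ℝ (gradient g) x :=
    ((hg.gradient_of_isOpen hΘ).differentiableOn one_ne_zero).differentiableAt (hΘ.mem_nhds hx)
  have h2 : DifferentiableAt ℝ (fderiv ℝ g) x :=
    ((hg.fderiv_of_isOpen (m := 1) hΘ (by norm_num)).differentiableOn
      one_ne_zero).differentiableAt (hΘ.mem_nhds hx)
  have h3 := ((EuclideanSpace.proj (𝕜 := ℝ) i).hasFDerivAt.comp x h1.hasFDerivAt)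
  have h4 := h2.hasFDerivAt.clm_apply (hasFDerivAt_const (EuclideanSpace.single i (1 : ℝ)) x)
  have h5 : (EuclideanSpace.proj (𝕜 := ℝ) i) ∘ gradient g
      = fun t => fderiv ℝ g t (EuclideanSpace.single i 1) := by
    ext t
    exact gradient_apply_eq_fderiv_single g t i
  rw [h5] at h3
  have h6 := congrArg (fun L => L (EuclideanSpace.single j (1 : ℝ))) (h3.unique h4)
  simpa using h6

/-- Apply `T'` to the approximate equation `T w ≈ z`. The condition on `ε` lets half of `‖w‖` be
absorbed, so `‖w‖ ≤ 2 ‖T'‖ ‖z‖`, and every error relative to `‖w‖` becomes one relative to `‖z‖`. -/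
theorem abs_sub_inner_le_of_linearization {E : Type*} [NormedAddCommGroup E]
    [InnerProductSpace ℝ E] {T T' : E →L[ℝ] E} (hT : ∀ u, T' (T u) = u) {v w z : E} {y ε : ℝ}
    (hw : ‖T w - z‖ ≤ ε * ‖w‖) (hy : |y - inner ℝ v w| ≤ ε * ‖w‖) (hε : ‖T'‖ * ε ≤ 1 / 2)
    (hε0 : 0 ≤ ε) :
    |y - inner ℝ v (T' z)| ≤ ε * ((1 + ‖v‖ * ‖T'‖) * (2 * ‖T'‖)) * ‖z‖ := by
  have h1 : ‖w - T' z‖ ≤ ‖T'‖ * (ε * ‖w‖) := by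
    have : w - T' z = T' (T w - z) := by rw [map_sub, hT]
    rw [this]
    exact (T'.le_opNorm _).trans (by gcongr)
  have h2 : ‖w‖ ≤ 2 * ‖T'‖ * ‖z‖ := by
    have h3 : ‖w‖ ≤ ‖w - T' z‖ + ‖T' z‖ := by simpa using norm_add_le (w - T' z) (T' z)
    have h4 : ‖T'‖ * (ε * ‖w‖) ≤ 1 / 2 * ‖w‖ := by
      rw [← mul_assoc]
      gcongr
    linarith [T'.le_opNorm z]
  have h5 : |inner ℝ v w - inner ℝ v (T' z)| ≤ ‖v‖ * (‖T'‖ * (ε * ‖w‖)) := by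
    rw [← inner_sub_right]
    exact (abs_real_inner_le_norm _ _).trans (by gcongr)
  calc |y - inner ℝ v (T' z)| ≤ ε * ‖w‖ + ‖v‖ * (‖T'‖ * (ε * ‖w‖)) :=
        (abs_sub_le _ _ _).trans (add_le_add hy h5)
    _ = ε * (1 + ‖v‖ * ‖T'‖) * ‖w‖ := by ring
    _ ≤ ε * (1 + ‖v‖ * ‖T'‖) * (2 * ‖T'‖ * ‖z‖) := by gcongr
    _ = _ := by ring

/-- Strict differentiability is essential, since both endpoints will vary with `n` and neither is
`θ` itself. -/
theorem exists_ball_abs_sub_sub_inner_gradient_le {τ : EuclideanSpace ℝ (Fin d) → ℝ}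
    {θ : EuclideanSpace ℝ (Fin d)} (hτ : ContDiffAt ℝ 1 τ θ) {ε : ℝ} (hε : 0 < ε) :
    ∃ r > 0, ∀ a ∈ Metric.ball θ r, ∀ b ∈ Metric.ball θ r,
      |τ b - τ a - inner ℝ (gradient τ θ) (b - a)| ≤ ε * ‖b - a‖ := by
  have h := (hτ.hasStrictFDerivAt one_ne_zero).isLittleO.bound hε
  rw [nhds_prod_eq] at h
  obtain ⟨s, hs, h⟩ := eventually_prod_self_iff'.1 h
  obtain ⟨r, hr, hrs⟩ := Metric.mem_nhds_iff.1 hs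
  refine ⟨r, hr, fun a ha b hb => ?_⟩
  have := h b (hrs hb) a (hrs ha)
  rwa [← toDual_gradient, InnerProductSpace.toDual_apply_apply, Real.norm_eq_abs] at this

end Calculus

/-! ### Score, observed information and consistency in the model classes. -/

namespace ModelClasses

variable {M : ℕ} {𝒳 : ℕ → Type*} [∀ n, MeasurableSpace (𝒳 n)] (𝓜 : ModelClasses M 𝒳)

theorem ae_law_density_pos (m : Fin M) (θ : 𝓜.Θ m) (n : ℕ) :
    ∀ᵐ x ∂𝓜.law m θ n, 0 < 𝓜.density m n θ x := by
  rw [law, ae_withDensity_iff (𝓜.measurable_density m n θ θ.2).ennreal_ofReal]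
  refine Eventually.of_forall fun x hx => ?_
  simpa using hx

variable {𝓜}

theorem IsMLE.score_eq_zero {m : Fin M} {n : ℕ} {x : 𝒳 n} {t : 𝓜.Θ m} (h : 𝓜.IsMLE m n x t)
    (hpos : ∀ θ ∈ 𝓜.Θ m, 0 < 𝓜.density m n θ x) : 𝓜.score m n t x = 0 := by
  have hmax : IsLocalMax (fun θ => 𝓜.logLik m n θ x) t := by
    filter_upwards [(𝓜.isOpen_Θ m).mem_nhds t.2] with θ hθ
    exact Real.log_le_log (hpos θ hθ) (h θ hθ)
  rw [score, gradient, hmax.fderiv_eq_zero, map_zero]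

variable {m m' : Fin M} {θ' : 𝓜.Θ m'}

theorem continuousOn_obsInfo {n : ℕ} {x : 𝒳 n}
    (h : ContDiffOn ℝ 2 (fun θ => 𝓜.logLik m n θ x) (𝓜.Θ m)) (i j : Fin (𝓜.dim m)) :
    ContinuousOn (fun θ => 𝓜.obsInfo m n θ x i j) (𝓜.Θ m) := by
  have h1 := (h.gradient_of_isOpen (𝓜.isOpen_Θ m)).continuousOn_fderiv_of_isOpen
    (𝓜.isOpen_Θ m) le_rfl
  exact ((EuclideanSpace.proj (𝕜 := ℝ) i).continuous.comp_continuousOn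
    (h1.clm_apply continuousOn_const)).neg

theorem isSymm_obsInfo {n : ℕ} {x : 𝒳 n}
    (h : ContDiffOn ℝ 2 (fun θ => 𝓜.logLik m n θ x) (𝓜.Θ m)) {θ : 𝓜.Param m} (hθ : θ ∈ 𝓜.Θ m) :
    (𝓜.obsInfo m n θ x).IsSymm := by
  ext i j
  have hs : IsSymmSndFDerivAt ℝ (fun t => 𝓜.logLik m n t x) θ :=
    (h.contDiffAt ((𝓜.isOpen_Θ m).mem_nhds hθ)).isSymmSndFDerivAt (by simp)
  have e (i j : Fin (𝓜.dim m)) := fderiv_gradient_apply_single h (𝓜.isOpen_Θ m) hθ i j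
  have := (e j i).trans ((hs _ _).trans (e i j).symm)
  exact congrArg Neg.neg this

/-- Symmetry passes to the limit: at one good sample point the entries `(i, j)` and `(j, i)` of `A
θ` are both within `ε / 2` of the same number. -/
theorem isSymm_of_unifTendstoInProb_obsInfo {N : Set (𝓜.Param m)}
    {A : 𝓜.Param m → Matrix (Fin (𝓜.dim m)) (Fin (𝓜.dim m)) ℝ}
    (hsmooth : ∀ n, ∀ᵐ x ∂𝓜.law m' θ' n, ContDiffOn ℝ 2 (fun θ => 𝓜.logLik m n θ x) (𝓜.Θ m))
    (hA : ∀ i j, UnifTendstoInProb (𝓜.law m' θ') N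
      (fun n θ x => (n : ℝ)⁻¹ * 𝓜.obsInfo m n θ x i j) (fun θ => A θ i j))
    {θ : 𝓜.Param m} (hθN : θ ∈ N) (hθ : θ ∈ 𝓜.Θ m) : (A θ).IsSymm := by
  ext i j
  refine eq_of_abs_sub_le_all fun ε hε => ?_
  obtain ⟨n, x, ⟨h1, h2⟩, h3⟩ := (((hA i j).holdsWHP (half_pos hε)).and
    ((hA j i).holdsWHP (half_pos hε))).and
      (HoldsWHP.of_ae (Eventually.of_forall hsmooth)) |>.exists
  have h1 := abs_lt.1 (h1 θ hθN)
  have h2 := abs_lt.1 (h2 θ hθN)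
  rw [(isSymm_obsInfo h3 hθ).apply] at h2
  rw [Matrix.transpose_apply, abs_le]
  constructor <;> linarith

/-- The mean value inequality is applied on a ball to the score compared with the linear map `-n
A(θ)`. Being an inequality, it suits a vector-valued score and gives one event valid for all `a`,
`b`, hence for a random `b`. -/
theorem exists_ball_holdsWHP_score_expansion {N : Set (𝓜.Param m)}
    {A : 𝓜.Param m → Matrix (Fin (𝓜.dim m)) (Fin (𝓜.dim m)) ℝ}
    (hsmooth : ∀ n, ∀ᵐ x ∂𝓜.law m' θ' n, ContDiffOn ℝ 2 (fun θ => 𝓜.logLik m n θ x) (𝓜.Θ m))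
    (hA : ∀ i j, UnifTendstoInProb (𝓜.law m' θ') N
      (fun n θ x => (n : ℝ)⁻¹ * 𝓜.obsInfo m n θ x i j) (fun θ => A θ i j))
    {θ : 𝓜.Param m} (hθN : N ∈ 𝓝 θ) (hθ : θ ∈ 𝓜.Θ m) {ε : ℝ} (hε : 0 < ε) :
    ∃ r > 0, HoldsWHP (𝓜.law m' θ') fun n x =>
      ∀ a ∈ Metric.ball θ r, ∀ b ∈ Metric.ball θ r,
        ‖𝓜.score m n b x - 𝓜.score m n a x
          + (n : ℝ) • Matrix.toEuclideanCLM (𝕜 := ℝ) (A θ) (b - a)‖ ≤ n * ε * ‖b - a‖ := by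
  have hNΘ : N ∩ 𝓜.Θ m ∈ 𝓝 θ := inter_mem hθN ((𝓜.isOpen_Θ m).mem_nhds hθ)
  -- Each entry of the derivative carries two errors of size `δ` (convergence and continuity of
  -- `A`), and the norm bound costs the dimension squared; the `+ 1` covers dimension zero.
  set δ : ℝ := ε / (2 * (𝓜.dim m * 𝓜.dim m + 1)) with hδ
  have hδ0 : 0 < δ := by positivity
  have hcont (i j : Fin (𝓜.dim m)) : ContinuousAt (fun t => A t i j) θ := by
    refine ContinuousOn.continuousAt (s := N ∩ 𝓜.Θ m) ?_ hNΘ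
    refine ((hA i j).mono Set.inter_subset_left).continuousOn fun n => ?_
    filter_upwards [hsmooth n] with x hx
    exact continuousOn_const.mul ((continuousOn_obsInfo hx i j).mono Set.inter_subset_right)
  have hnear : ∀ᶠ t in 𝓝 θ, ∀ i j, |A t i j - A θ i j| < δ := by
    refine eventually_all.2 fun i => eventually_all.2 fun j => ?_
    exact Metric.tendsto_nhds.1 (hcont i j) δ hδ0
  obtain ⟨r, hr, hball⟩ := Metric.mem_nhds_iff.1 (inter_mem hNΘ hnear)
  refine ⟨r, hr, ?_⟩
  have hU := HoldsWHP.forall_finite fun i => HoldsWHP.forall_finite fun j =>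
    (hA i j).holdsWHP hδ0
  refine hU.mono_ae ?_
  filter_upwards [eventually_gt_atTop 0] with n hn
  filter_upwards [hsmooth n] with x hx hxA a ha b hb
  have hn' : (0 : ℝ) < n := by exact_mod_cast hn
  have hdiff (t : 𝓜.Param m) (ht : t ∈ Metric.ball θ r) :
      DifferentiableAt ℝ (fun s => 𝓜.score m n s x) t :=
    ((hx.gradient_of_isOpen (𝓜.isOpen_Θ m)).differentiableOn one_ne_zero).differentiableAt
      ((𝓜.isOpen_Θ m).mem_nhds (hball ht).1.2)
  have hbound (t : 𝓜.Param m) (ht : t ∈ Metric.ball θ r) :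
      ‖fderiv ℝ (fun s => 𝓜.score m n s x) t
        - -((n : ℝ) • Matrix.toEuclideanCLM (𝕜 := ℝ) (A θ))‖ ≤ n * ε := by
    refine (norm_le_of_apply_single_le (ε := n * (2 * δ)) _ (fun i j => ?_)
      (by positivity)).trans ?_
    · have h1 := hxA i j t (hball ht).1.1
      have h2 : |A t i j - A θ i j| < δ := (hball ht).2 i j
      have h3 : (fderiv ℝ (fun s => 𝓜.score m n s x) t
          - -((n : ℝ) • Matrix.toEuclideanCLM (𝕜 := ℝ) (A θ))) (EuclideanSpace.single j 1) i
          = n * -(((n : ℝ)⁻¹ * 𝓜.obsInfo m n t x i j - A t i j) + (A t i j - A θ i j)) := by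
        have h4 : (Matrix.toEuclideanCLM (𝕜 := ℝ) (A θ)) (EuclideanSpace.single j 1) i
            = A θ i j := by
          rw [Matrix.ofLp_toEuclideanCLM]
          simp
        simp only [FunLike.coe_sub, FunLike.coe_neg, FunLike.coe_smul, Pi.sub_apply,
          Pi.neg_apply, Pi.smul_apply, PiLp.sub_apply, PiLp.neg_apply, PiLp.smul_apply, h4,
          obsInfo, Matrix.of_apply, smul_eq_mul]
        field_simp
        ring
      rw [h3, abs_mul, abs_neg, abs_of_pos hn']
      gcongr
      exact (abs_add_le _ _).trans (by linarith)
    · have : (𝓜.dim m : ℝ) * 𝓜.dim m * (n * (2 * δ))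
          = n * (ε * ((𝓜.dim m * 𝓜.dim m) / (𝓜.dim m * 𝓜.dim m + 1))) := by
        rw [hδ]
        field_simp
      rw [this]
      gcongr
      refine mul_le_of_le_one_right hε.le ((div_le_one (by positivity)).2 (by linarith))
  have h := (convex_ball θ r).norm_image_sub_le_of_norm_fderiv_le' hdiff hbound ha hb
  simpa using h

/-- Consistency of the maximum likelihood estimator for the maximizer of `K`. -/
theorem holdsWHP_estimator_mem
    (hpos : ∀ n, ∀ᵐ x ∂𝓜.law m' θ' n, ∀ θ ∈ 𝓜.Θ m, 0 < 𝓜.density m n θ x)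
    (hsmooth : ∀ n, ∀ᵐ x ∂𝓜.law m' θ' n, ContDiffOn ℝ 2 (fun θ => 𝓜.logLik m n θ x) (𝓜.Θ m))
    {K : 𝓜.Param m → ℝ} {θstar : 𝓜.Θ m}
    (hθstar : ∀ θ ∈ 𝓜.Θ m, θ ≠ θstar → K θ < K θstar)
    (hloglik : ∀ C ⊆ 𝓜.Θ m, IsCompact C → UnifTendstoInProb (𝓜.law m' θ') C
      (fun n θ x => (n : ℝ)⁻¹ * Real.log (𝓜.density m n θ x / 𝓜.density m' n θ' x)) K)
    (hcompact : ∃ C ⊆ 𝓜.Θ m, IsCompact C ∧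
      Tendsto (fun n => 𝓜.law m' θ' n
        {x | ∃ θ ∈ 𝓜.Θ m \ C, 𝓜.density m n θstar x ≤ 𝓜.density m n θ x}) atTop (𝓝 0))
    {θhat : ∀ n, 𝒳 n → 𝓜.Θ m}
    (hMLE : HoldsWHP (𝓜.law m' θ') fun n x => 𝓜.IsMLE m n x (θhat n x))
    {U : Set (𝓜.Param m)} (hU : U ∈ 𝓝 (θstar : 𝓜.Param m)) :
    HoldsWHP (𝓜.law m' θ') fun n x => (θhat n x : 𝓜.Param m) ∈ U := by
  obtain ⟨C, hCΘ, hC, hCW⟩ := hcompact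
  have hCW' : HoldsWHP (𝓜.law m' θ') fun n x =>
      ∀ θ ∈ 𝓜.Θ m \ C, 𝓜.density m n θ x < 𝓜.density m n θstar x :=
    hCW.congr fun n => by simp [and_assoc]
  -- The point `θstar` need not lie in `C`, yet the uniform convergence must hold there too.
  have hDΘ : insert (θstar : 𝓜.Param m) C ⊆ 𝓜.Θ m := Set.insert_subset θstar.2 hCΘ
  have hunif := hloglik _ hDΘ (hC.insert _)
  have hKcont : ContinuousOn K (insert (θstar : 𝓜.Param m) C) := by
    refine hunif.continuousOn fun n => ?_
    filter_upwards [hpos n, hsmooth n, 𝓜.ae_law_density_pos m' θ' n] with x hx hxs hx'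
    refine continuousOn_const.mul ?_
    refine ((hxs.continuousOn.mono hDΘ).sub (continuousOn_const
      (c := Real.log (𝓜.density m' n θ' x)))).congr fun θ hθ => ?_
    exact Real.log_div (hx θ (hDΘ hθ)).ne' hx'.ne'
  -- Well-separation of the maximum: `K` is continuous on the compact set `C \ interior U`, so it
  -- attains there a value strictly below `K θstar`.
  obtain ⟨δ, hδ, hgap⟩ : ∃ δ > 0, ∀ θ ∈ C \ interior U, K θ + δ ≤ K θstar := by
    rcases (C \ interior U).eq_empty_or_nonempty with he | hne
    · exact ⟨1, one_pos, by simp [he]⟩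
    · obtain ⟨t, ht, hmax⟩ := (hC.diff isOpen_interior).exists_isMaxOn hne
        (hKcont.mono (Set.sdiff_subset.trans (Set.subset_insert _ _)))
      have hne : t ≠ θstar := by
        rintro rfl
        exact ht.2 (mem_interior_iff_mem_nhds.2 hU)
      refine ⟨K θstar - K t, sub_pos.2 (hθstar t (hCΘ ht.1) hne), fun θ hθ => ?_⟩
      have : K θ ≤ K t := hmax hθ
      linarith
  refine ((hMLE.and hCW').and (hunif.holdsWHP (half_pos hδ))).mono_ae
    (Eventually.of_forall fun n => ?_)
  filter_upwards [hpos n, 𝓜.ae_law_density_pos m' θ' n] with x hx hx' ⟨⟨h1, h2⟩, h3⟩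
  have hmem : (θhat n x : 𝓜.Param m) ∈ C := by
    by_contra hcon
    exact (h2 _ ⟨(θhat n x).2, hcon⟩).not_ge (h1 _ θstar.2)
  by_contra hcon
  have hK := hgap _ ⟨hmem, fun h => hcon (interior_subset h)⟩
  have ha := abs_lt.1 (h3 _ (Set.mem_insert_of_mem _ hmem))
  have hb := abs_lt.1 (h3 _ (Set.mem_insert _ _))
  -- An estimate outside `U` would have to overcome a gap `δ` in `K` with two errors each below `δ /
  -- 2`.
  have hle : (n : ℝ)⁻¹ * Real.log (𝓜.density m n θstar x / 𝓜.density m' n θ' x)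
      ≤ (n : ℝ)⁻¹ * Real.log (𝓜.density m n (θhat n x) x / 𝓜.density m' n θ' x) := by
    have := hx _ θstar.2
    have := h1 _ θstar.2
    gcongr
  linarith [ha.2, hb.1]

end ModelClasses

/-! ### Asymptotic normality of the estimated functional. -/

theorem mainTheorem1 {M : ℕ} {𝒳 : ℕ → Type*} [∀ n, MeasurableSpace (𝒳 n)]
    (𝓜 : ModelClasses M 𝒳) (m m' : Fin M) (θ' : 𝓜.Θ m')
    -- the functional `τ_m`, continuously differentiable on the parameter set
    (τ : 𝓜.Param m → ℝ) (hτ : ContDiffOn ℝ 1 τ (𝓜.Θ m))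
    -- almost surely under the true law, the likelihood is positive and its logarithm is `C²`
    (hpos : ∀ n, ∀ᵐ x ∂𝓜.law m' θ' n, ∀ θ ∈ 𝓜.Θ m, 0 < 𝓜.density m n θ x)
    (hsmooth : ∀ n, ∀ᵐ x ∂𝓜.law m' θ' n, ContDiffOn ℝ 2 (fun θ => 𝓜.logLik m n θ x) (𝓜.Θ m))
    -- the Kullback–Leibler functional, its limit, and the projections
    (hint : ∀ n, ∀ θ ∈ 𝓜.Θ m, Integrable (𝓜.klIntegrand m m' θ' n θ) (𝓜.ν n))
    (K : 𝓜.Param m → ℝ)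
    (hK : ∀ θ ∈ 𝓜.Θ m, Tendsto (fun n : ℕ => (n : ℝ)⁻¹ * 𝓜.kl m m' θ' n θ) atTop (𝓝 (K θ)))
    (θseq : ℕ → 𝓜.Θ m)
    (hθseq : ∀ᶠ n in atTop, IsMaxOn (𝓜.kl m m' θ' n) (𝓜.Θ m) (θseq n))
    (θstar : 𝓜.Θ m)
    (hθstar : ∀ θ ∈ 𝓜.Θ m, θ ≠ θstar → K θ < K θstar)
    (hlim : Tendsto θseq atTop (𝓝 θstar))
    -- the normalised log-likelihood ratio converges to `K`, uniformly on compact sets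
    (hloglik : ∀ C ⊆ 𝓜.Θ m, IsCompact C → UnifTendstoInProb (𝓜.law m' θ') C
      (fun n θ x => (n : ℝ)⁻¹ * Real.log (𝓜.density m n θ x / 𝓜.density m' n θ' x)) K)
    -- outside some compact set the likelihood stays below its value at `θstar`
    (hcompact : ∃ C ⊆ 𝓜.Θ m, IsCompact C ∧
      Tendsto (fun n => 𝓜.law m' θ' n
        {x | ∃ θ ∈ 𝓜.Θ m \ C, 𝓜.density m n θstar x ≤ 𝓜.density m n θ x}) atTop (𝓝 0))
    -- the normalised observed information converges uniformly near `θstar`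
    (A : 𝓜.Param m → Matrix (Fin (𝓜.dim m)) (Fin (𝓜.dim m)) ℝ)
    (hA : ∃ N ∈ 𝓝 (θstar : 𝓜.Param m), ∀ i j, UnifTendstoInProb (𝓜.law m' θ') N
      (fun n θ x => (n : ℝ)⁻¹ * 𝓜.obsInfo m n θ x i j) (fun θ => A θ i j))
    (hAinv : IsUnit (A θstar))
    -- the limiting covariance matrix of the score, and asymptotic normality of the score
    (S : Matrix (Fin (𝓜.dim m)) (Fin (𝓜.dim m)) ℝ)
    (hL2 : ∀ᶠ n in atTop, MemLp (𝓜.score m n (θseq n)) 2 (𝓜.law m' θ' n))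
    (hS : Tendsto (fun n : ℕ => (n : ℝ)⁻¹ • 𝓜.scoreCov m m' θ' n (θseq n)) atTop (𝓝 S))
    (hscore : TendstoInDistribution
      (fun (n : ℕ) x => (√(n : ℝ))⁻¹ • 𝓜.score m n (θseq n) x) atTop
      id (𝓜.law m' θ') (multivariateGaussian 0 S))
    -- the estimator: measurable, and a maximum likelihood estimate with probability tending to one
    (θhat : ∀ n, 𝒳 n → 𝓜.Θ m)
    (hmeas : ∀ n, AEMeasurable (θhat n) (𝓜.law m' θ' n))
    (hMLE : Tendsto (fun n => 𝓜.law m' θ' n {x | ¬ 𝓜.IsMLE m n x (θhat n x)}) atTop (𝓝 0)) :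
    0 ≤ deltaVariance τ θstar (sandwich (A θstar) S) ∧
    TendstoInDistribution
      (fun (n : ℕ) x => √(n : ℝ) * (τ (θhat n x) - τ (θseq n))) atTop
      id (𝓜.law m' θ')
      (gaussianReal 0 (deltaVariance τ θstar (sandwich (A θstar) S)).toNNReal) := by
  obtain ⟨N, hN, hA⟩ := hA
  set T := Matrix.toEuclideanCLM (𝕜 := ℝ) (A θstar) with hT
  set T' := Matrix.toEuclideanCLM (𝕜 := ℝ) (A θstar)⁻¹ with hT'
  set v := gradient τ (θstar : 𝓜.Param m) with hv
  have hSpos : S.PosSemidef := by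
    refine posSemidef_of_tendsto hS ?_
    filter_upwards [hL2] with n hn
    exact (posSemidef_covariance hn).smul (by positivity)
  have hsymm : (A θstar).IsSymm :=
    ModelClasses.isSymm_of_unifTendstoInProb_obsInfo hsmooth hA (mem_of_mem_nhds hN) θstar.2
  have hΓ : deltaVariance τ θstar (sandwich (A θstar) S)
      = (T' v).ofLp ⬝ᵥ (S *ᵥ (T' v).ofLp) := dotProduct_sandwich_mulVec hsymm _
  have hadj (u : 𝓜.Param m) : inner ℝ v (T' u) = inner ℝ (T' v) u := by
    rw [real_inner_comm u, hT', Matrix.inner_toEuclideanCLM, Matrix.inner_toEuclideanCLM,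
      Matrix.dotProduct_mulVec, ← Matrix.mulVec_transpose, Matrix.transpose_nonsing_inv, hsymm,
      dotProduct_comm]
  refine ⟨by rw [hΓ]; exact hSpos.dotProduct_mulVec_nonneg _, ?_⟩
  have hlin : TendstoInDistribution
      (fun (n : ℕ) x => inner ℝ v (T' ((√(n : ℝ))⁻¹ • 𝓜.score m n (θseq n) x))) atTop
      id (𝓜.law m' θ')
      (gaussianReal 0 (deltaVariance τ θstar (sandwich (A θstar) S)).toNNReal) := by
    have h := hscore.continuous_comp (g := fun u => inner ℝ v (T' u)) (by fun_prop)
    refine ⟨h.forall_aemeasurable, aemeasurable_id, ?_⟩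
    convert! h.tendsto using 2
    refine congrArg 𝓝 (Subtype.ext ?_)
    change Measure.map id _ = Measure.map ((fun u => inner ℝ v (T' u)) ∘ id) _
    rw [Measure.map_id, Function.comp_id, funext hadj, multivariateGaussian_map_inner hSpos, hΓ]
  refine hlin.of_holdsWHP_dist_lt (fun n => ?_) fun δ hδ => ?_
  · have hτm : Measurable ((𝓜.Θ m).domRestrict τ) :=
      (continuousOn_iff_continuous_domRestrict.1 hτ.continuousOn).measurable
    exact ((hτm.comp_aemeasurable (hmeas n)).sub_const _).const_mul _
  refine HoldsWHP.lt_of_le_mul_norm hscore (fun η hη => ?_) hδ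
  -- The first bound permits the absorption of `‖w‖`; the second brings the total error below `η
  -- ‖z‖`.
  obtain ⟨ε, hε, hε1, hε2⟩ : ∃ ε > 0, ‖T'‖ * ε ≤ 1 / 2 ∧
      ε * ((1 + ‖v‖ * ‖T'‖) * (2 * ‖T'‖)) ≤ η := by
    have h1 : Tendsto (fun ε : ℝ => ‖T'‖ * ε) (𝓝[>] 0) (𝓝 0) :=
      tendsto_nhdsWithin_of_tendsto_nhds
        (Continuous.tendsto' (by fun_prop) _ _ (mul_zero _))
    have h2 : Tendsto (fun ε : ℝ => ε * ((1 + ‖v‖ * ‖T'‖) * (2 * ‖T'‖))) (𝓝[>] 0) (𝓝 0) :=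
      tendsto_nhdsWithin_of_tendsto_nhds
        (Continuous.tendsto' (by fun_prop) _ _ (zero_mul _))
    obtain ⟨ε, hε, h1, h2⟩ := (eventually_mem_nhdsWithin.and ((h1.eventually_le_const
      (half_pos one_pos)).and (h2.eventually_le_const hη))).exists
    exact ⟨ε, hε, h1, h2⟩
  obtain ⟨r₁, hr₁, hexp⟩ :=
    ModelClasses.exists_ball_holdsWHP_score_expansion hsmooth hA hN θstar.2 hε
  obtain ⟨r₂, hr₂, hdelta⟩ := exists_ball_abs_sub_sub_inner_gradient_le
    (hτ.contDiffAt ((𝓜.isOpen_Θ m).mem_nhds θstar.2)) hε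
  have hball := inter_mem (Metric.ball_mem_nhds (θstar : 𝓜.Param m) hr₁)
    (Metric.ball_mem_nhds (θstar : 𝓜.Param m) hr₂)
  have hcons := ModelClasses.holdsWHP_estimator_mem hpos hsmooth hθstar hloglik hcompact hMLE hball
  have hseq : ∀ᶠ n in atTop, (θseq n : 𝓜.Param m) ∈
      Metric.ball (θstar : 𝓜.Param m) r₁ ∩ Metric.ball (θstar : 𝓜.Param m) r₂ :=
    (continuous_subtype_val.tendsto θstar).comp hlim hball
  have hMLE' : HoldsWHP (𝓜.law m' θ') fun n x => 𝓜.IsMLE m n x (θhat n x) := hMLE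
  refine ((hMLE'.and hcons).and hexp).mono_ae ?_
  filter_upwards [hseq, eventually_gt_atTop 0] with n hn hn0
  filter_upwards [hpos n] with x hx ⟨⟨h1, h2⟩, h3⟩
  have hs : 0 < √(n : ℝ) := Real.sqrt_pos.2 (by exact_mod_cast hn0)
  have hss : (n : ℝ) = √(n : ℝ) * √(n : ℝ) := (Real.mul_self_sqrt n.cast_nonneg).symm
  set s := √(n : ℝ)
  have h3 := h3 _ hn.1 _ h2.1
  rw [h1.score_eq_zero hx, zero_sub, hss] at h3
  have h4 := hdelta _ hn.2 _ h2.2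
  set D := (θhat n x : 𝓜.Param m) - θseq n
  -- Here `w = √n (θhat - θseq n)` and `z` is the score divided by `√n`; the two remaining goals are
  -- the score expansion divided by `√n` and the delta-method bound multiplied by `√n`.
  refine (abs_sub_inner_le_of_linearization (T := T) (w := s • D) (ε := ε)
    (toEuclideanCLM_inv_apply_toEuclideanCLM hAinv) ?_ ?_ hε1 hε.le).trans (by gcongr)
  · have e : T (s • D) - s⁻¹ • 𝓜.score m n (θseq n) x
        = s⁻¹ • (-𝓜.score m n (θseq n) x + (s * s) • T D) := by
      rw [map_smul, smul_add, smul_smul, smul_neg, inv_mul_cancel_left₀ hs.ne']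
      abel
    rw [e, norm_smul, norm_smul, norm_inv, Real.norm_of_nonneg hs.le]
    calc s⁻¹ * ‖-𝓜.score m n (θseq n) x + (s * s) • T D‖ ≤ s⁻¹ * (s * s * ε * ‖D‖) := by gcongr
      _ = ε * (s * ‖D‖) := by field_simp
  · rw [inner_smul_right, ← mul_sub, abs_mul, abs_of_pos hs, norm_smul,
      Real.norm_of_nonneg hs.le]
    calc s * _ ≤ s * (ε * ‖D‖) := by gcongr
      _ = _ := by ring
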